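/- Let $(X,d)$ be a compact metric space, $f:X\to X$ a homeomorphism and $\pi_0$ a Borel probability measure on $X$. All logarithms are to base $2$. For a finite nonempty alphabet $M$, a causal coding and estimation scheme over the noiseless channel with alphabet $M$ (whose capacity is $\log_2|M|$) consists of measurable maps $\delta_t:X^{t+1}\to M$ and maps $\gamma_t:M^{t+1}\to X$, $t\ge 0$; it generates from the initial state $x$ the symbols $q_t=\delta_t(x,f(x),\dots,f^t(x))$ and the estimates $\hat x_t(x)=\gamma_t(q_0,\dots,q_t)$. Asymptotic almost sure estimation with accuracy $\varepsilon>0$ can be achieved over the channel if some scheme satisfies $$\pi_0\Bigl(\bigl\{x\in X:\ \limsup_{t\to\infty}d\bigl(f^t(x),\hat x_t(x)\bigr)\le\varepsilon\bigr\}\Bigr)=1 .$$ Let $C_\varepsilon\in[0,\infty]$ be the infimum of the capacities $\log_2|M|$ of the channels over which this can be achieved ($\infty$ if there are none), and let $C_0:=\lim_{\varepsilon\downarrow0}C_\varepsilon=\sup_{\varepsilon>0}C_\varepsilon\in[0,\infty]$. For an $f$-invariant Borel probability measure $\mu$ let $$h_\mu(f)=\sup_{\mathcal P}\lim_{n\to\infty}\frac1n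 H_\mu\Bigl(\bigvee_{i=0}^{n-1}f^{-i}\mathcal P\Bigr)\in[0,\infty],\qquad H_\mu(\mathcal Q)=-\sum_{Q\in\mathcal Q}\mu(Q)\log_2\mu(Q),$$ be its Kolmogorov--Sinai entropy, where the supremum is over all finite Borel partitions $\mathcal P$ of $X$. **Theorem.** (1) If $\pi_0$ is $f$-invariant, then $C_0\ge h_{\pi_0}(f)$. (2) If $\pi_*$ is an $f$-invariant Borel probability measure that is absolutely continuous with respect to $\pi_0$ (where $\pi_0$ itself need not be invariant), then $C_0\ge h_{\pi_*}(f)$. The cases $h_{\pi_0}(f)=\infty$ and $h_{\pi_*}(f)=\infty$ are included: in these cases there is no finite alphabet over whose noiseless channel asymptotic almost sure estimation can be achieved for every $\varepsilon>0$. -/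

import Mathlib

open MeasureTheory Filter Topology

/-- Causal (zero-delay) coding and estimation policies over a noiseless channel with input
alphabet `M`: at time `t` the coder sends `q_t = coder t (x_0, …, x_t)` and the estimator outputs
`estimator t (q_0, …, q_t)`. -/
structure CodingScheme (X M : Type*) [MeasurableSpace X] [MeasurableSpace M] where
  coder : (t : ℕ) → (Fin (t + 1) → X) → M
  measurable_coder : ∀ t, Measurable (coder t)
  estimator : (t : ℕ) → (Fin (t + 1) → M) → X

/-- The estimate of the state at time `t` generated by the initial state `x` of the system
`x_{t+1} = f x_t`. -/
def CodingScheme.estimate {X M : Type*} [MeasurableSpace X] [MeasurableSpace M]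
    (S : CodingScheme X M) (f : X → X) (x : X) (t : ℕ) : X :=
  S.estimator t fun i => S.coder i fun j => f^[j] x

/-- Asymptotic almost sure estimation with accuracy `ε` can be achieved over the noiseless channel
with an alphabet of `k` symbols. The discrete sigma-algebra is used on the alphabet `Fin k`. -/
def AsymptoticASAchievable {X : Type*} [MetricSpace X] [MeasurableSpace X]
    (f : X → X) (π₀ : Measure X) (k : ℕ) (ε : ℝ) : Prop :=
  ∃ S : CodingScheme X (Fin k),
    π₀ {x | limsup (fun t : ℕ => dist (f^[t] x) (S.estimate f x t)) atTop ≤ ε} = 1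

/-- The capacity `log₂ k` of the noiseless channel with `k` input symbols. -/
noncomputable def channelCapacity (k : ℕ) : EReal := ((Real.logb 2 k : ℝ) : EReal)

/-- `C_ε`: the smallest capacity of a channel over which asymptotic almost sure estimation with
accuracy `ε` can be achieved (`⊤` if there is none). -/
noncomputable def criticalCapacityAt {X : Type*} [MetricSpace X] [MeasurableSpace X]
    (f : X → X) (π₀ : Measure X) (ε : ℝ) : EReal :=
  sInf {c | ∃ k : ℕ, 0 < k ∧ AsymptoticASAchievable f π₀ k ε ∧ c = channelCapacity k}

/-- `C_0`: the limit of `C_ε` as `ε ↓ 0`, written as a supremum; `tendsto_criticalCapacityAt`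
shows that it is this limit. -/
noncomputable def criticalCapacity {X : Type*} [MetricSpace X] [MeasurableSpace X]
    (f : X → X) (π₀ : Measure X) : EReal :=
  ⨆ ε : Set.Ioi (0 : ℝ), criticalCapacityAt f π₀ ε

theorem AsymptoticASAchievable.mono {X : Type*} [MetricSpace X] [MeasurableSpace X]
    {f : X → X} {π₀ : Measure X} [IsProbabilityMeasure π₀] {k : ℕ} {ε ε' : ℝ} (h : ε ≤ ε')
    (hk : AsymptoticASAchievable f π₀ k ε) : AsymptoticASAchievable f π₀ k ε' := by
  obtain ⟨S, hS⟩ := hk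
  refine ⟨S, le_antisymm prob_le_one ?_⟩
  rw [← hS]
  exact measure_mono fun x hx => le_trans hx h

theorem tendsto_criticalCapacityAt {X : Type*} [MetricSpace X] [MeasurableSpace X]
    (f : X → X) (π₀ : Measure X) [IsProbabilityMeasure π₀] :
    Tendsto (criticalCapacityAt f π₀) (𝓝[>] 0) (𝓝 (criticalCapacity f π₀)) := by
  have hanti : Antitone (criticalCapacityAt f π₀) := by
    intro ε ε' h
    apply sInf_le_sInf
    rintro c ⟨k, hk, hach, rfl⟩
    exact ⟨k, hk, hach.mono h, rfl⟩
  have := hanti.tendsto_nhdsGT 0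
  rwa [sSup_image'] at this

/-- The Shannon entropy (base 2) of the labelled finite partition `{ξ⁻¹(i)}` given by a map
`ξ : X → ι`; empty cells contribute `0`. -/
noncomputable def partitionEntropy {X ι : Type*} [MeasurableSpace X] [Fintype ι]
    (μ : Measure X) (ξ : X → ι) : ℝ :=
  -∑ i, μ.real (ξ ⁻¹' {i}) * Real.logb 2 (μ.real (ξ ⁻¹' {i}))

/-- The labelling of the refined partition `P ∨ f⁻¹P ∨ … ∨ f⁻⁽ⁿ⁻¹⁾P`, where `P` is given by `ξ`. -/
def refinedLabel {X ι : Type*} (f : X → X) (ξ : X → ι) (n : ℕ) (x : X) : Fin n → ι :=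
  fun i => ξ (f^[i] x)

/-- `h_μ(f; P) = lim (1/n) H_μ(Pⁿ)`; the limit exists for invariant `μ` and is then the `limsup`. -/
noncomputable def entropyOfPartition {X ι : Type*} [MeasurableSpace X] [Fintype ι]
    (μ : Measure X) (f : X → X) (ξ : X → ι) : EReal :=
  limsup (fun n : ℕ => ((partitionEntropy μ (refinedLabel f ξ n) / n : ℝ) : EReal)) atTop

/-- The Kolmogorov–Sinai (metric) entropy `h_μ(f)`: the supremum of `h_μ(f; P)` over all finite
measurable partitions `P`, each given by a measurable labelling `ξ : X → Fin k`. -/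
noncomputable def metricEntropy {X : Type*} [MeasurableSpace X]
    (μ : Measure X) (f : X → X) : EReal :=
  ⨆ (k : ℕ) (ξ : X → Fin k) (_ : Measurable ξ), entropyOfPartition μ f ξ

/-! A scheme over k symbols whose estimates are eventually accurate reveals, up to rare errors,
which cell of a finite partition `ξ` the state visits at each late time. By inner regularity `ξ` is
uniformly locally constant on a closed set of measure near 1, so the accuracy needed depends on `ξ`
and the allowed loss δ, not on the scheme. From some time T on, each of n successive labels can be
guessed from the k^(T+n) possible symbol strings with error probability at most η. The Fano-type
bound `partitionEntropy_le_of_guess` then bounds the block entropy by (T + n) log k plus n times an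
overhead vanishing with η. Invariance moves the block back to time 0, and division by n removes T:
this is `entropyOfPartition_le_of_estimate`.

Only μ-almost sure estimation enters, and it passes from π₀ to any μ ≪ π₀, so both claims are
instances of one. -/

/-! ### Gibbs' inequality and a Fano-type bound -/

/-- **Gibbs' inequality**: the Shannon entropy of `p` is at most its cross entropy relative to any
positive subprobability vector `r`. -/
theorem neg_sum_mul_logb_le_neg_sum_mul_logb {ι : Type*} [Fintype ι] {p r : ι → ℝ}
    (hp : ∀ i, 0 ≤ p i) (hr : ∀ i, 0 < r i) (hp1 : ∑ i, p i = 1) (hr1 : ∑ i, r i ≤ 1) :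
    -∑ i, p i * Real.logb 2 (p i) ≤ ∑ i, p i * -Real.logb 2 (r i) := by
  have hlog : 0 < Real.log 2 := Real.log_pos one_lt_two
  have key : ∀ i, p i * Real.log (r i) - p i * Real.log (p i) ≤ r i - p i := by
    intro i
    rcases (hp i).eq_or_lt with h | h
    · simp [← h, (hr i).le]
    · have := Real.log_le_sub_one_of_pos (div_pos (hr i) h)
      rw [Real.log_div (hr i).ne' h.ne'] at this
      calc p i * Real.log (r i) - p i * Real.log (p i)
          = p i * (Real.log (r i) - Real.log (p i)) := by ring
        _ ≤ p i * (r i / p i - 1) := by gcongr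
        _ = r i - p i := by field_simp
  have hsum := Finset.sum_le_sum fun i (_ : i ∈ Finset.univ) => key i
  simp only [Finset.sum_sub_distrib] at hsum
  have : -∑ i, p i * Real.log (p i) ≤ ∑ i, p i * -Real.log (r i) := by
    simp only [mul_neg, Finset.sum_neg_distrib]
    linarith
  simp only [Real.logb, ← neg_div, mul_div_assoc', ← Finset.sum_div]
  gcongr

/-- The transition weights of the symmetric channel on `ι` with crossover probability `η`. -/
noncomputable def symmetricWeight {ι : Type*} [Fintype ι] [DecidableEq ι] (η : ℝ) (a b : ι) : ℝ :=
  if a = b then 1 - η else η / Fintype.card ι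

theorem symmetricWeight_pos {ι : Type*} [Fintype ι] [DecidableEq ι] {η : ℝ} (h0 : 0 < η)
    (h1 : η < 1) (a b : ι) : 0 < symmetricWeight η a b := by
  have : 0 < Fintype.card ι := Fintype.card_pos_iff.2 ⟨a⟩
  unfold symmetricWeight
  split_ifs
  · linarith
  · positivity

/-- The exact sum is 1 - η/|ι|; a subprobability vector is enough for Gibbs' inequality. -/
theorem sum_symmetricWeight_le_one {ι : Type*} [Fintype ι] [DecidableEq ι] {η : ℝ} (h0 : 0 < η)
    (b : ι) : ∑ a, symmetricWeight η a b ≤ 1 := by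
  have hc : 0 < Fintype.card ι := Fintype.card_pos_iff.2 ⟨b⟩
  have : ∀ a, symmetricWeight η a b ≤ (if a = b then 1 - η else 0) + η / Fintype.card ι := by
    intro a
    unfold symmetricWeight
    split_ifs
    · have : 0 ≤ η / Fintype.card ι := by positivity
      linarith
    · simp
  refine (Finset.sum_le_sum fun a _ => this a).trans ?_
  rw [Finset.sum_add_distrib]
  simp only [Finset.sum_ite_eq', Finset.mem_univ, if_true, Finset.sum_const, Finset.card_univ,
    nsmul_eq_mul]
  rw [mul_div_cancel₀ _ (by positivity)]
  linarith

theorem neg_logb_symmetricWeight_le {ι : Type*} [Fintype ι] [DecidableEq ι] {η : ℝ} (h0 : 0 < η)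
    (h1 : η < 1) (a b : ι) :
    -Real.logb 2 (symmetricWeight η a b) ≤
      -Real.logb 2 (1 - η) + if a = b then 0 else Real.logb 2 (Fintype.card ι / η) := by
  unfold symmetricWeight
  split_ifs
  · simp
  · rw [← Real.logb_inv, inv_div]
    have := Real.logb_nonpos (b := 2) one_lt_two (x := 1 - η) (by linarith) (by linarith)
    linarith

/-- The entropy overhead per symbol when a symbol from `m` possibilities is guessed with error
probability at most `η`. -/
noncomputable def guessOverhead (m : ℕ) (η : ℝ) : ℝ :=
  -Real.logb 2 (1 - η) + η * Real.logb 2 (m / η)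

theorem tendsto_guessOverhead (m : ℕ) : Tendsto (guessOverhead m) (𝓝[>] 0) (𝓝 0) := by
  have h1 : Tendsto (fun η : ℝ => -Real.logb 2 (1 - η)) (𝓝[>] 0) (𝓝 0) := by
    have : ContinuousAt (fun η : ℝ => -Real.logb 2 (1 - η)) 0 := by
      unfold Real.logb
      refine ((ContinuousAt.log (by fun_prop) (by simp)).div_const _).neg
    have := this.tendsto
    simp only [sub_zero, Real.logb_one, neg_zero] at this
    exact this.mono_left nhdsWithin_le_nhds
  have h2 : Tendsto (fun η : ℝ => η * Real.logb 2 (m / η)) (𝓝[>] 0) (𝓝 0) := by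
    have hc : Continuous fun η : ℝ => (η * Real.log m - η * Real.log η) / Real.log 2 := by
      exact ((by fun_prop : Continuous fun η : ℝ => η * Real.log m).sub
        Real.continuous_mul_log).div_const _
    have := hc.tendsto 0
    simp only [zero_mul, sub_zero, zero_div] at this
    rcases Nat.eq_zero_or_pos m with rfl | hm
    · simp
    · refine (this.mono_left nhdsWithin_le_nhds).congr' ?_
      filter_upwards [self_mem_nhdsWithin] with η (hη : 0 < η)
      rw [Real.logb, Real.log_div (by positivity) hη.ne']
      ring
  have := h1.add h2
  rw [add_zero] at this
  exact this

/-- If the coordinates of the label `β` can be guessed from a code `q` with values in a finite set,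
each with error probability at most `η`, then the entropy of `β` is bounded by the logarithm of the
number of code words, up to an overhead for each coordinate. -/
theorem partitionEntropy_le_of_guess {X ι Q : Type*} [MeasurableSpace X] {μ : Measure X}
    [IsProbabilityMeasure μ] [Fintype ι] [DecidableEq ι] [MeasurableSpace ι]
    [DiscreteMeasurableSpace ι] [Fintype Q] {n : ℕ} {β : X → Fin n → ι} (hβ : Measurable β)
    (q : X → Q) (guess : Q → Fin n → ι) {η : ℝ} (h0 : 0 < η) (h1 : η < 1)
    (hmeas : ∀ i, MeasurableSet {x | β x i ≠ guess (q x) i})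
    (herr : ∀ i, μ.real {x | β x i ≠ guess (q x) i} ≤ η) :
    partitionEntropy μ β ≤
      Real.logb 2 (Fintype.card Q) + n * guessOverhead (Fintype.card ι) η := by
  obtain ⟨x₀⟩ : Nonempty X := nonempty_of_isProbabilityMeasure μ
  have hQ : 0 < (Fintype.card Q : ℝ) := by exact_mod_cast Fintype.card_pos_iff.2 ⟨q x₀⟩
  -- Reference vector for Gibbs: draw a code word uniformly and pass its guess through n independent
  -- symmetric channels. Keeping one term of the mixture costs log |Q|, and each wrong coordinate
  -- costs at most `L` more.
  let w : (Fin n → ι) → Q → ℝ := fun b c => ∏ i, symmetricWeight η (b i) (guess c i)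
  have hw : ∀ b c, 0 < w b c := fun b c => Finset.prod_pos fun i _ => symmetricWeight_pos h0 h1 _ _
  let r : (Fin n → ι) → ℝ := fun b => ∑ c, (Fintype.card Q : ℝ)⁻¹ * w b c
  have hr_le : ∀ b c, (Fintype.card Q : ℝ)⁻¹ * w b c ≤ r b := fun b c =>
    Finset.single_le_sum (f := fun c => (Fintype.card Q : ℝ)⁻¹ * w b c)
      (fun c _ => (mul_pos (inv_pos.2 hQ) (hw b c)).le) (Finset.mem_univ c)
  have hr : ∀ b, 0 < r b := fun b => (mul_pos (inv_pos.2 hQ) (hw b (q x₀))).trans_le (hr_le _ _)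
  have hr1 : ∑ b, r b ≤ 1 := by
    have hwc : ∀ c, ∑ b, w b c ≤ 1 := by
      intro c
      have : ∑ b, w b c = ∏ i, ∑ a, symmetricWeight η a (guess c i) := by
        rw [Finset.prod_univ_sum, Fintype.piFinset_univ]
      rw [this]
      exact Finset.prod_le_one
        (fun i _ => Finset.sum_nonneg fun a _ => (symmetricWeight_pos h0 h1 _ _).le)
        (fun i _ => sum_symmetricWeight_le_one h0 _)
    calc ∑ b, r b = ∑ c, (Fintype.card Q : ℝ)⁻¹ * ∑ b, w b c := by
          rw [Finset.sum_comm]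
          simp only [Finset.mul_sum]
      _ ≤ ∑ _c : Q, (Fintype.card Q : ℝ)⁻¹ * 1 := by
          gcongr with c
          exact hwc c
      _ = 1 := by simp [hQ.ne']
  have : IsProbabilityMeasure (μ.map β) := Measure.isProbabilityMeasure_map hβ.aemeasurable
  have hp : ∀ b, (μ.map β).real {b} = μ.real (β ⁻¹' {b}) := fun b =>
    map_measureReal_apply hβ (measurableSet_singleton b)
  have hgibbs := neg_sum_mul_logb_le_neg_sum_mul_logb (p := fun b => μ.real (β ⁻¹' {b})) (r := r)
    (fun _ => measureReal_nonneg) hr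
    (by simp only [← hp]; rw [sum_measureReal_singleton]; simp) hr1
  -- Written as an integral over X, the cross entropy can be bounded pointwise, using at each x the
  -- term of its own code word `q x`.
  have hint : ∑ b, μ.real (β ⁻¹' {b}) * -Real.logb 2 (r b) = ∫ x, -Real.logb 2 (r (β x)) ∂μ := by
    have := integral_fintype (μ := μ.map β) (f := fun b => -Real.logb 2 (r b)) .of_finite
    rw [integral_map hβ.aemeasurable (measurable_of_finite _).aestronglyMeasurable] at this
    simp only [this, hp, smul_eq_mul]
  let L := Real.logb 2 (Fintype.card ι / η)
  let E : Fin n → X → ℝ := fun i => Set.indicator {x | β x i ≠ guess (q x) i} fun _ => L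
  have hEint : ∀ i, Integrable (E i) μ := fun i => (integrable_const L).indicator (hmeas i)
  have hpt : ∀ x, -Real.logb 2 (r (β x)) ≤
      Real.logb 2 (Fintype.card Q) + n * -Real.logb 2 (1 - η) + ∑ i, E i x := by
    intro x
    have hlow := Real.logb_le_logb_of_le one_lt_two (mul_pos (inv_pos.2 hQ) (hw (β x) (q x)))
      (hr_le (β x) (q x))
    rw [Real.logb_mul (inv_pos.2 hQ).ne' (hw _ _).ne', Real.logb_inv,
      Real.logb_prod _ _ fun i _ => (symmetricWeight_pos h0 h1 _ _).ne'] at hlow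
    have hsum := Finset.sum_le_sum fun i (_ : i ∈ Finset.univ) =>
      neg_logb_symmetricWeight_le h0 h1 (β x i) (guess (q x) i)
    rw [Finset.sum_neg_distrib, Finset.sum_add_distrib] at hsum
    simp only [Finset.sum_const, Finset.card_univ, Fintype.card_fin, nsmul_eq_mul] at hsum
    have hE : ∀ i, E i x =
        if β x i = guess (q x) i then 0 else Real.logb 2 (Fintype.card ι / η) := by
      intro i
      by_cases h : β x i = guess (q x) i <;> simp [E, L, h]
    simp only [hE]
    linarith
  -- The index serves to produce a letter: ι may be empty when n = 0.
  have hL : ∀ i : Fin n, 0 ≤ L := by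
    intro i
    have : 1 ≤ Fintype.card ι := Fintype.card_pos_iff.2 ⟨β x₀ i⟩
    refine Real.logb_nonneg one_lt_two ((one_le_div h0).2 ?_)
    have : (1 : ℝ) ≤ Fintype.card ι := by exact_mod_cast this
    linarith
  have hEη : ∀ i, ∫ x, E i x ∂μ ≤ η * L := by
    intro i
    rw [integral_indicator_const _ (hmeas i), smul_eq_mul]
    exact mul_le_mul_of_nonneg_right (herr i) (hL i)
  calc partitionEntropy μ β ≤ ∫ x, -Real.logb 2 (r (β x)) ∂μ := hgibbs.trans hint.le
    _ ≤ ∫ x, (Real.logb 2 (Fintype.card Q) + n * -Real.logb 2 (1 - η) + ∑ i, E i x) ∂μ := by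
        refine integral_mono ?_ ?_ hpt
        · have : Integrable (fun b => -Real.logb 2 (r b)) (μ.map β) := .of_finite
          exact this.comp_measurable hβ
        · exact (integrable_const _).add (integrable_finsetSum _ fun i _ => hEint i)
    _ = Real.logb 2 (Fintype.card Q) + n * -Real.logb 2 (1 - η) + ∑ i, ∫ x, E i x ∂μ := by
        rw [integral_add (integrable_const _) (integrable_finsetSum _ fun i _ => hEint i),
          integral_finsetSum _ fun i _ => hEint i]
        simp
    _ ≤ Real.logb 2 (Fintype.card Q) + n * -Real.logb 2 (1 - η) + ∑ _i : Fin n, η * L := by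
        gcongr with i
        exact hEη i
    _ = _ := by
        simp only [Finset.sum_const, Finset.card_univ, Fintype.card_fin, nsmul_eq_mul,
          guessOverhead, L]
        ring

/-! ### Uniformity up to small probability -/

/-- A finite-valued measurable map on a compact metric space is locally constant, uniformly, on a
closed set of almost full measure. -/
theorem exists_isClosed_forall_dist_lt_eq {X ι : Type*} [MetricSpace X] [CompactSpace X]
    [MeasurableSpace X] [BorelSpace X] (μ : Measure X) [IsProbabilityMeasure μ] [Fintype ι]
    [MeasurableSpace ι] [DiscreteMeasurableSpace ι] {ξ : X → ι} (hξ : Measurable ξ) {η : ℝ}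
    (hη : 0 < η) :
    ∃ K : Set X, IsClosed K ∧ μ.real Kᶜ ≤ η ∧
      ∃ r > 0, ∀ x ∈ K, ∀ y ∈ K, dist x y < r → ξ x = ξ y := by
  have hη' : 0 < η / (Fintype.card ι + 1) := by positivity
  have hK : ∀ i, ∃ F ⊆ ξ ⁻¹' {i}, IsClosed F ∧
      μ (ξ ⁻¹' {i} \ F) < ENNReal.ofReal (η / (Fintype.card ι + 1)) := fun i =>
    (hξ (measurableSet_singleton i)).exists_isClosed_sdiff_lt (measure_ne_top _ _)
      (ENNReal.ofReal_pos.2 hη').ne'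
  choose F hFξ hFc hFμ using hK
  refine ⟨⋃ i, F i, isClosed_iUnion_of_finite hFc, ?_, ?_⟩
  · have hsub : (⋃ i, F i)ᶜ ⊆ ⋃ i, ξ ⁻¹' {i} \ F i := fun x hx =>
      Set.mem_iUnion.2 ⟨ξ x, rfl, fun h => hx (Set.mem_iUnion.2 ⟨_, h⟩)⟩
    calc μ.real (⋃ i, F i)ᶜ ≤ μ.real (⋃ i, ξ ⁻¹' {i} \ F i) := measureReal_mono hsub
      _ ≤ ∑ i, μ.real (ξ ⁻¹' {i} \ F i) := measureReal_iUnion_fintype_le _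
      _ ≤ ∑ _i : ι, η / (Fintype.card ι + 1) := by
          gcongr with i
          exact ENNReal.toReal_le_of_le_ofReal hη'.le (hFμ i).le
      _ = η * (Fintype.card ι / (Fintype.card ι + 1)) := by
          simp only [Finset.sum_const, Finset.card_univ, nsmul_eq_mul]
          ring
      _ ≤ η * 1 := by
          gcongr
          exact (div_le_one (by positivity)).2 (by linarith)
      _ = η := mul_one η
  -- Disjoint compact sets lie at positive distance; the "eventually" form lets finitely many pairs
  -- share one r.
  · have hsep : ∀ p : ι × ι, ∀ᶠ r : ℝ in 𝓝[>] 0, p.1 ≠ p.2 → ∀ x ∈ F p.1, ∀ y ∈ F p.2,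
        r ≤ dist x y := by
      rintro ⟨i, j⟩
      by_cases hij : i = j
      · simp [hij]
      have hdisj : Disjoint (F i) (F j) :=
        ((Set.disjoint_singleton.2 hij).preimage ξ).mono (hFξ i) (hFξ j)
      obtain ⟨r, hr, h⟩ := Metric.exists_pos_forall_lt_edist (hFc i).isCompact (hFc j) hdisj
      filter_upwards [Ioo_mem_nhdsGT (NNReal.coe_pos.2 hr)] with s hs _ x hx y hy
      have := h x hx y hy
      rw [edist_nndist, ENNReal.coe_lt_coe, ← NNReal.coe_lt_coe, coe_nndist] at this
      exact (hs.2.trans this).le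
    obtain ⟨r, hr, hr0⟩ := ((eventually_all.2 hsep).and self_mem_nhdsWithin).exists
    refine ⟨r, hr0, fun x hx y hy hxy => ?_⟩
    obtain ⟨i, hi⟩ := Set.mem_iUnion.1 hx
    obtain ⟨j, hj⟩ := Set.mem_iUnion.1 hy
    rw [show ξ x = i from hFξ i hi, show ξ y = j from hFξ j hj]
    by_contra hij
    exact absurd (hr (i, j) hij x hi y hj) (not_le.2 hxy)

/-- The channel symbols sent before time `t`. -/
def CodingScheme.symbols {X M : Type*} [MeasurableSpace X] [MeasurableSpace M]
    (S : CodingScheme X M) (f : X → X) (x : X) (t : ℕ) : Fin t → M :=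
  fun i => S.coder i fun j => f^[j] x

theorem CodingScheme.measurable_estimate {X M : Type*} [MeasurableSpace X] [MeasurableSpace M]
    [Countable M] [DiscreteMeasurableSpace M] (S : CodingScheme X M) {f : X → X}
    (hf : Measurable f) (t : ℕ) : Measurable fun x => S.estimate f x t := by
  have hq : Measurable fun x => (fun i : Fin (t + 1) => S.coder i fun j => f^[j] x) :=
    measurable_pi_lambda _ fun i =>
      (S.measurable_coder i).comp (measurable_pi_lambda _ fun j => hf.iterate j)
  exact (Measurable.of_discrete (f := S.estimator t)).comp hq

/-- If the estimation error is almost surely eventually smaller than `ρ`, then it is smaller than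
`ρ` from some fixed time on, up to an event of small probability. -/
theorem CodingScheme.exists_forall_dist_lt {X M : Type*} [MetricSpace X] [CompactSpace X]
    [MeasurableSpace X] [BorelSpace X] [MeasurableSpace M] [Countable M]
    [DiscreteMeasurableSpace M] (S : CodingScheme X M) {f : X → X} (hf : Measurable f)
    (μ : Measure X) [IsProbabilityMeasure μ] {ε ρ : ℝ} (hερ : ε < ρ)
    (hS : ∀ᵐ x ∂μ, limsup (fun t : ℕ => dist (f^[t] x) (S.estimate f x t)) atTop ≤ ε)
    {η : ℝ} (hη : 0 < η) :
    ∃ T : ℕ, ∃ A : Set X, MeasurableSet A ∧ μ.real Aᶜ ≤ η ∧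
      ∀ x ∈ A, ∀ t ≥ T, dist (f^[t] x) (S.estimate f x t) < ρ := by
  let A : ℕ → Set X := fun T => {x | ∀ t ≥ T, dist (f^[t] x) (S.estimate f x t) < ρ}
  have hA : ∀ T, MeasurableSet (A T) := fun T => by
    have : A T = ⋂ t ≥ T, {x | dist (f^[t] x) (S.estimate f x t) < ρ} := by
      ext x
      simp [A]
    rw [this]
    exact .iInter fun t => .iInter fun _ =>
      measurableSet_lt ((hf.iterate t).dist (S.measurable_estimate hf t)) measurable_const
  have hanti : Antitone fun T => (A T)ᶜ := fun T T' h =>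
    Set.compl_subset_compl.2 fun x hx t ht => hx t (h.trans ht)
  have hnull : μ (⋂ T, (A T)ᶜ) = 0 := by
    refine measure_mono_null (fun x hx => ?_) (ae_iff.1 hS)
    simp only [Set.mem_ofPred_eq]
    intro hlim
    -- A real `limsup` controls the sequence only when it is bounded; compactness bounds the
    -- distances.
    have hbdd : IsBoundedUnder (· ≤ ·) atTop fun t : ℕ => dist (f^[t] x) (S.estimate f x t) :=
      isBoundedUnder_of ⟨Metric.diam (Set.univ : Set X), fun t =>
        Metric.dist_le_diam_of_mem isCompact_univ.isBounded (Set.mem_univ _) (Set.mem_univ _)⟩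
    obtain ⟨T, hT⟩ := eventually_atTop.1 (eventually_lt_of_limsup_lt (hlim.trans_lt hερ) hbdd)
    exact Set.mem_iInter.1 hx T hT
  have hlim := tendsto_measure_iInter_atTop (μ := μ)
    (fun T => (hA T).compl.nullMeasurableSet) hanti ⟨0, measure_ne_top _ _⟩
  rw [hnull] at hlim
  obtain ⟨T, hT⟩ := (hlim.eventually_lt_const (ENNReal.ofReal_pos.2 hη)).exists
  exact ⟨T, A T, hA T, ENNReal.toReal_le_of_le_ofReal hη.le hT.le, fun x hx => hx⟩

theorem measurable_refinedLabel {X ι : Type*} [MeasurableSpace X] [MeasurableSpace ι] {f : X → X}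
    (hf : Measurable f) {ξ : X → ι} (hξ : Measurable ξ) (n : ℕ) :
    Measurable (refinedLabel f ξ n) :=
  measurable_pi_lambda _ fun i => hξ.comp (hf.iterate i)

theorem partitionEntropy_comp {X ι : Type*} [MeasurableSpace X] [Fintype ι] [MeasurableSpace ι]
    [DiscreteMeasurableSpace ι] {μ : Measure X} {g : X → X} (hg : MeasurePreserving g μ μ)
    {ξ : X → ι} (hξ : Measurable ξ) : partitionEntropy μ (ξ ∘ g) = partitionEntropy μ ξ := by
  simp only [partitionEntropy, Set.preimage_comp, measureReal_def,
    hg.measure_preimage (hξ (measurableSet_singleton _)).nullMeasurableSet]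

/-- If a labelling is uniformly locally constant on a closed set `K` at scale `r`, then it can be
recovered on `K` from any estimate with error below `r / 2`. -/
theorem exists_label_of_estimate {X ι : Type*} [MetricSpace X] {ξ : X → ι} {K : Set X} {r : ℝ}
    (hK : ∀ x ∈ K, ∀ y ∈ K, dist x y < r → ξ x = ξ y) :
    ∃ g : X → ι, ∀ x ∈ K, ∀ y, dist x y < r / 2 → ξ x = g y := by
  classical
  -- Any point of K within r/2 of y will do: two such points are less than r apart. The fallback
  -- value is never used.
  refine ⟨fun y => if h : ∃ x ∈ K, dist x y < r / 2 then ξ h.choose else ξ y, ?_⟩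
  intro x hx y hxy
  have h : ∃ x ∈ K, dist x y < r / 2 := ⟨x, hx, hxy⟩
  simp only [h, dif_pos]
  refine hK x hx _ h.choose_spec.1 ?_
  have := h.choose_spec.2
  have := dist_triangle_right x h.choose y
  linarith

/-! ### Entropy against capacity -/

/-- ε is fixed before k and the scheme, as the comparison with the supremum C_0 requires. The
waiting time T does depend on the scheme, but its cost T log k vanishes after division by n. -/
theorem entropyOfPartition_le_of_estimate {X ι : Type*} [MetricSpace X] [CompactSpace X]
    [MeasurableSpace X] [BorelSpace X] [Fintype ι] [MeasurableSpace ι] [DiscreteMeasurableSpace ι]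
    {f : X → X} {μ : Measure X} [IsProbabilityMeasure μ] (hf : MeasurePreserving f μ μ)
    {ξ : X → ι} (hξ : Measurable ξ) {δ : ℝ} (hδ : 0 < δ) :
    ∃ ε > 0, ∀ k : ℕ, ∀ S : CodingScheme X (Fin k),
      (∀ᵐ x ∂μ, limsup (fun t : ℕ => dist (f^[t] x) (S.estimate f x t)) atTop ≤ ε) →
      entropyOfPartition μ f ξ ≤ channelCapacity k + (δ : EReal) := by
  classical
  obtain ⟨η, ⟨hov, hη0, hη1⟩⟩ : ∃ η, guessOverhead (Fintype.card ι) η < δ / 2 ∧ 0 < η ∧ η < 1 :=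
    (((tendsto_guessOverhead _).eventually_lt_const (half_pos hδ)).and
      (Ioo_mem_nhdsGT one_pos)).exists
  -- The error η is split evenly between leaving K and a late estimation error.
  obtain ⟨K, hKc, hKμ, r, hr, hK⟩ := exists_isClosed_forall_dist_lt_eq μ hξ (half_pos hη0)
  obtain ⟨g, hg⟩ := exists_label_of_estimate hK
  refine ⟨r / 4, by positivity, fun k S hS => ?_⟩
  obtain ⟨T, A, hA, hAμ, hAS⟩ := S.exists_forall_dist_lt hf.measurable μ
    (show r / 4 < r / 2 by linarith) hS (half_pos hη0)
  have hbound : ∀ n : ℕ, partitionEntropy μ (refinedLabel f ξ n) ≤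
      (T + n) * Real.logb 2 k + n * (δ / 2) := by
    intro n
    have hmeasf := hf.measurable
    have hlab := measurable_refinedLabel hmeasf hξ n
    rw [← partitionEntropy_comp (hf.iterate T) hlab]
    -- The estimate at time T + i uses T + i + 1 ≤ T + n symbols, so the string sent before time T +
    -- n suffices.
    let guess : (Fin (T + n) → Fin k) → Fin n → ι := fun q i =>
      g (S.estimator (T + i) fun j => q (Fin.castLE (by omega) j))
    have hguess : ∀ x i, guess (S.symbols f x (T + n)) i = g (S.estimate f x (T + i)) :=
      fun x i => rfl
    have hlabel : ∀ x i, (refinedLabel f ξ n ∘ f^[T]) x i = ξ (f^[T + i] x) := by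
      intro x i
      rw [add_comm, Function.iterate_add_apply]
      rfl
    have hgm : ∀ t, Measurable fun x => g (S.estimate f x t) := fun t => by
      have hq : Measurable fun x => S.symbols f x (t + 1) :=
        measurable_pi_lambda _ fun i => (S.measurable_coder i).comp
          (measurable_pi_lambda _ fun j => hmeasf.iterate j)
      exact (Measurable.of_discrete (f := fun q => g (S.estimator t q))).comp hq
    have hle := partitionEntropy_le_of_guess (μ := μ) (hlab.comp (hmeasf.iterate T))
      (fun x => S.symbols f x (T + n)) guess hη0 hη1
      (fun i => by
        simp only [hguess, hlabel]
        exact (measurableSet_eq_fun (hξ.comp (hmeasf.iterate _)) (hgm _)).compl)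
      (fun i => by
        simp only [hguess, hlabel]
        have hsub : {x | ξ (f^[T + i] x) ≠ g (S.estimate f x (T + i))} ⊆
            Aᶜ ∪ f^[T + i] ⁻¹' Kᶜ := by
          intro x hx
          by_contra hcon
          simp only [Set.mem_union, Set.mem_compl_iff, Set.mem_preimage, not_or, not_not] at hcon
          exact hx (hg _ hcon.2 _ (hAS x hcon.1 _ (by omega)))
        have hKT : μ.real (f^[T + i] ⁻¹' Kᶜ) = μ.real Kᶜ := by
          simp only [measureReal_def, (hf.iterate (T + i)).measure_preimage
            hKc.measurableSet.compl.nullMeasurableSet]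
        have := measureReal_mono (μ := μ) hsub
        have := measureReal_union_le (μ := μ) Aᶜ (f^[T + i] ⁻¹' Kᶜ)
        linarith)
    refine hle.trans ?_
    simp only [Fintype.card_pi, Fintype.card_fin, Finset.prod_const, Finset.card_univ,
      Nat.cast_pow, Real.logb_pow, Nat.cast_add]
    gcongr
  have hlim : Tendsto (fun n : ℕ => T * Real.logb 2 k / n) atTop (𝓝 0) :=
    tendsto_const_div_atTop_nhds_zero_nat _
  refine limsup_le_of_le (by isBoundedDefault) ?_
  filter_upwards [hlim.eventually_lt_const (half_pos hδ), eventually_gt_atTop 0] with n hn hn0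
  rw [channelCapacity, ← EReal.coe_add, EReal.coe_le_coe_iff]
  have hn0' : (0 : ℝ) < n := by exact_mod_cast hn0
  rw [div_lt_iff₀ hn0'] at hn
  rw [div_le_iff₀ hn0']
  have := hbound n
  nlinarith

/-- Measure 1 yields a null complement because the limsup is measurable, hence so is the event. -/
theorem AsymptoticASAchievable.exists_ae_le {X : Type*} [MetricSpace X] [CompactSpace X]
    [MeasurableSpace X] [BorelSpace X] {f : X → X} (hf : Measurable f) {π₀ : Measure X}
    [IsProbabilityMeasure π₀] {k : ℕ} {ε : ℝ} (h : AsymptoticASAchievable f π₀ k ε) :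
    ∃ S : CodingScheme X (Fin k),
      ∀ᵐ x ∂π₀, limsup (fun t : ℕ => dist (f^[t] x) (S.estimate f x t)) atTop ≤ ε := by
  obtain ⟨S, hS⟩ := h
  refine ⟨S, ?_⟩
  have hm : Measurable fun x => limsup (fun t : ℕ => dist (f^[t] x) (S.estimate f x t)) atTop :=
    .limsup fun t => (hf.iterate t).dist (S.measurable_estimate hf t)
  exact (prob_compl_eq_zero_iff (measurableSet_le hm measurable_const)).2 hS

theorem metricEntropy_le_criticalCapacity {X : Type*} [MetricSpace X] [CompactSpace X]
    [MeasurableSpace X] [BorelSpace X] {f : X → X} {π₀ μ : Measure X} [IsProbabilityMeasure π₀]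
    [IsProbabilityMeasure μ] (hf : MeasurePreserving f μ μ) (hμ : μ ≪ π₀) :
    metricEntropy μ f ≤ criticalCapacity f π₀ := by
  refine iSup_le fun m => iSup_le fun ξ => iSup_le fun hξ => ?_
  refine EReal.le_of_forall_lt_iff_le.1 fun z hz => ?_
  -- The gap z - w serves as δ, leaving room for a channel of capacity below w.
  obtain ⟨w, hw, hwz⟩ := EReal.lt_iff_exists_real_btwn.1 hz
  obtain ⟨ε, hε, h⟩ := entropyOfPartition_le_of_estimate hf hξ
    (sub_pos.2 (EReal.coe_lt_coe_iff.1 hwz))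
  have hε' : criticalCapacityAt f π₀ ε < w :=
    (le_iSup (fun ε : Set.Ioi (0 : ℝ) => criticalCapacityAt f π₀ ε) ⟨ε, hε⟩).trans_lt hw
  obtain ⟨_, ⟨k, -, hach, rfl⟩, hkw⟩ := sInf_lt_iff.1 hε'
  obtain ⟨S, hS⟩ := hach.exists_ae_le hf.measurable
  refine (h k S (hμ.ae_le hS)).trans ?_
  rw [channelCapacity, EReal.coe_lt_coe_iff] at hkw
  rw [channelCapacity, ← EReal.coe_add, EReal.coe_le_coe_iff]
  linarith

/-- If a fixed finite alphabet suffices for every accuracy, then the critical capacity is finite. -/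
theorem criticalCapacity_ne_top {X : Type*} [MetricSpace X] [MeasurableSpace X] {f : X → X}
    {π₀ : Measure X}
    (h : ∃ k : ℕ, 0 < k ∧ ∀ ε : ℝ, 0 < ε → AsymptoticASAchievable f π₀ k ε) :
    criticalCapacity f π₀ ≠ ⊤ := by
  obtain ⟨k, hk, hach⟩ := h
  have : criticalCapacity f π₀ ≤ channelCapacity k :=
    iSup_le fun ε => sInf_le ⟨k, hk, hach ε ε.2, rfl⟩
  exact (this.trans_lt (EReal.coe_lt_top _)).ne

theorem mainTheorem2 {X : Type*} [MetricSpace X] [CompactSpace X] [MeasurableSpace X]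
    [BorelSpace X] (f : X ≃ₜ X) (π₀ : Measure X) [IsProbabilityMeasure π₀] :
    (MeasurePreserving f π₀ π₀ →
      metricEntropy π₀ f ≤ criticalCapacity f π₀ ∧
      (metricEntropy π₀ f = ⊤ →
        ¬ ∃ k : ℕ, 0 < k ∧ ∀ ε : ℝ, 0 < ε → AsymptoticASAchievable f π₀ k ε)) ∧
    (∀ π' : Measure X, IsProbabilityMeasure π' → MeasurePreserving f π' π' → π' ≪ π₀ →
      metricEntropy π' f ≤ criticalCapacity f π₀ ∧
      (metricEntropy π' f = ⊤ →
        ¬ ∃ k : ℕ, 0 < k ∧ ∀ ε : ℝ, 0 < ε → AsymptoticASAchievable f π₀ k ε)) := by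
  have main : ∀ μ : Measure X, IsProbabilityMeasure μ → MeasurePreserving f μ μ → μ ≪ π₀ →
      metricEntropy μ f ≤ criticalCapacity f π₀ ∧
      (metricEntropy μ f = ⊤ →
        ¬ ∃ k : ℕ, 0 < k ∧ ∀ ε : ℝ, 0 < ε → AsymptoticASAchievable f π₀ k ε) := by
    intro μ _ hf hμ
    have hle := metricEntropy_le_criticalCapacity hf hμ
    exact ⟨hle, fun htop hk => criticalCapacity_ne_top hk (top_le_iff.1 (htop ▸ hle))⟩
  exact ⟨fun hf => main π₀ inferInstance hf .rfl, main⟩
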